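/- Let $\ell>0$, $\alpha>0$ and $b>0$. There is a constant $\Gamma>0$, depending only on $\ell,\alpha,b$ (in particular independent of $\varepsilon$), with the following property. Let $0<k<\alpha$, $0<\varepsilon<1$, $\gamma\in\mathbb R$, $T>0$, let $\Omega=[0,\ell]\times[0,T]$, and let $h_0,h_1:[0,\ell]\to\mathbb R$ and $\varphi_0,\varphi_1:[0,T]\to\mathbb R$ be given data. Let $u\in C^2(\Omega)$, such that $u_{xxt}=\partial_{xx}(u_t)$ exists on $\Omega$, be a classical solution of the perturbed sine-Gordon Neumann problem $$\partial_{xx}(\varepsilon u_t+u)-\partial_t(u_t+\alpha u)=\sin u+\gamma\ \text{ in }\Omega,$$ $$u(x,0)=h_0(x),\quad u_t(x,0)=h_1(x)\quad(0\le x\le \ell),\qquad u_x(0,t)=\varphi_0(t),\quad u_x(\ell,t)=\varphi_1(t)\quad(0\le t\le T),$$ and let $U\in C^2(\Omega)$ be a classical solution of the reduced hyperbolic Neumann problem with the same initial and boundary data, $$U_{xx}-\partial_t(U_t+\alpha U)=\sin U+\gamma\ \text{ in }\Omega,$$ $$U(x,0)=h_0(x),\quad U_t(x,0)=h_1(x)\quad(0\le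 x\le \ell),\qquad U_x(0,t)=\varphi_0(t),\quad U_x(\ell,t)=\varphi_1(t)\quad(0\le t\le T),$$ such that $U_{xxt}=\partial_{xx}(U_t)$ exists and $|U_{xxt}|\le b$ on $\Omega$. Put $d=u-U$ and $T_\varepsilon=\log(1/\varepsilon^k)$. Then for every $t\le T$ with $1\le t<T_\varepsilon$ the function $x\mapsto|d(x,t)|$ is bounded on $[0,\ell]$ and $$0\le \sup_{0\le x\le \ell}|d(x,t)|\le \Gamma\,\varepsilon^{1-k/\alpha}\,\log\frac1{\varepsilon^k}.$$ -/

import Mathlib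

open Set

noncomputable section

/-- Partial derivative in the space variable of `f : (x, t) ↦ f x t` on the segment `[0, ℓ]`
(one-sided at the endpoints). -/
def Dx (ℓ : ℝ) (f : ℝ → ℝ → ℝ) : ℝ → ℝ → ℝ :=
  fun x t => derivWithin (fun y => f y t) (Icc 0 ℓ) x

/-- Partial derivative in the time variable on the segment `[0, T]` (one-sided at the
endpoints). -/
def Dt (T : ℝ) (f : ℝ → ℝ → ℝ) : ℝ → ℝ → ℝ :=
  fun x t => derivWithin (fun s => f x s) (Icc 0 T) t

/-- The partial derivative in `x` exists at every point of `[0, ℓ] × [0, T]`. -/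
def HasDx (ℓ T : ℝ) (f : ℝ → ℝ → ℝ) : Prop :=
  ∀ x ∈ Icc 0 ℓ, ∀ t ∈ Icc 0 T, DifferentiableWithinAt ℝ (fun y => f y t) (Icc 0 ℓ) x

/-- The partial derivative in `t` exists at every point of `[0, ℓ] × [0, T]`. -/
def HasDt (ℓ T : ℝ) (f : ℝ → ℝ → ℝ) : Prop :=
  ∀ x ∈ Icc 0 ℓ, ∀ t ∈ Icc 0 T, DifferentiableWithinAt ℝ (fun s => f x s) (Icc 0 T) t

/-- Joint continuity on the closed rectangle `[0, ℓ] × [0, T]`. -/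
def ContOnRect (ℓ T : ℝ) (f : ℝ → ℝ → ℝ) : Prop :=
  ContinuousOn (fun p : ℝ × ℝ => f p.1 p.2) (Icc 0 ℓ ×ˢ Icc 0 T)

/-- `f` is of class `C¹` on the closed rectangle `[0, ℓ] × [0, T]`. -/
structure IsC1OnRect (ℓ T : ℝ) (f : ℝ → ℝ → ℝ) : Prop where
  cont : ContOnRect ℓ T f
  hasDx : HasDx ℓ T f
  hasDt : HasDt ℓ T f
  contDx : ContOnRect ℓ T (Dx ℓ f)
  contDt : ContOnRect ℓ T (Dt T f)

/-- `f` is of class `C²` on the closed rectangle: it is `C¹`, and so are both its first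
partial derivatives. -/
structure IsC2OnRect (ℓ T : ℝ) (f : ℝ → ℝ → ℝ) : Prop where
  c1 : IsC1OnRect ℓ T f
  c1Dx : IsC1OnRect ℓ T (Dx ℓ f)
  c1Dt : IsC1OnRect ℓ T (Dt T f)

/-- The third derivative `f_xxt = ∂ₓ∂ₓ(∂ₜ f)`. -/
def Dxxt (ℓ T : ℝ) (f : ℝ → ℝ → ℝ) : ℝ → ℝ → ℝ :=
  Dx ℓ (Dx ℓ (Dt T f))

/-- For a function of class `C²`: the derivative `f_xxt` exists at every point of the closed
rectangle. -/
def HasDxxt (ℓ T : ℝ) (f : ℝ → ℝ → ℝ) : Prop :=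
  HasDx ℓ T (Dx ℓ (Dt T f))

/-- The initial conditions `f(x, 0) = h₀(x)`, `f_t(x, 0) = h₁(x)` and the Neumann boundary
conditions `f_x(0, t) = φ₀(t)`, `f_x(ℓ, t) = φ₁(t)`. -/
structure NeumannData (ℓ T : ℝ) (h₀ h₁ φ₀ φ₁ : ℝ → ℝ) (f : ℝ → ℝ → ℝ) : Prop where
  init : ∀ x ∈ Icc 0 ℓ, f x 0 = h₀ x
  init_t : ∀ x ∈ Icc 0 ℓ, Dt T f x 0 = h₁ x
  left : ∀ t ∈ Icc 0 T, Dx ℓ f 0 t = φ₀ t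
  right : ∀ t ∈ Icc 0 T, Dx ℓ f ℓ t = φ₁ t

/-- `u` is a classical solution, on `[0, ℓ] × [0, T]`, of the Neumann problem for the perturbed
sine-Gordon equation `∂ₓₓ(ε u_t + u) - ∂ₜ(u_t + α u) = sin u + γ`, expanded as
`u_xx + ε u_xxt - u_tt - α u_t = sin u + γ`. -/
structure IsPerturbedSolution (ℓ T α γ ε : ℝ) (h₀ h₁ φ₀ φ₁ : ℝ → ℝ) (u : ℝ → ℝ → ℝ) :
    Prop where
  c2 : IsC2OnRect ℓ T u
  hasDxxt : HasDxxt ℓ T u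
  eqn : ∀ x ∈ Icc 0 ℓ, ∀ t ∈ Icc 0 T,
    Dx ℓ (Dx ℓ u) x t + ε * Dxxt ℓ T u x t - Dt T (Dt T u) x t - α * Dt T u x t
      = Real.sin (u x t) + γ
  data : NeumannData ℓ T h₀ h₁ φ₀ φ₁ u

/-- `U` is a classical solution, on `[0, ℓ] × [0, T]`, of the reduced hyperbolic Neumann problem
`U_xx - ∂ₜ(U_t + α U) = sin U + γ`. -/
structure IsReducedSolution (ℓ T α γ : ℝ) (h₀ h₁ φ₀ φ₁ : ℝ → ℝ) (U : ℝ → ℝ → ℝ) :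
    Prop where
  c2 : IsC2OnRect ℓ T U
  eqn : ∀ x ∈ Icc 0 ℓ, ∀ t ∈ Icc 0 T,
    Dx ℓ (Dx ℓ U) x t - Dt T (Dt T U) x t - α * Dt T U x t = Real.sin (U x t) + γ
  data : NeumannData ℓ T h₀ h₁ φ₀ φ₁ U

/-- The set of values `|d(x, t)|`, `0 ≤ x ≤ ℓ`. -/
def absValues (ℓ : ℝ) (d : ℝ → ℝ → ℝ) (t : ℝ) : Set ℝ :=
  (fun x => |d x t|) '' Icc 0 ℓ

/-- `S(t) = sup_{0 ≤ x ≤ ℓ} |d(x, t)|`. -/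
def supAbs (ℓ : ℝ) (d : ℝ → ℝ → ℝ) (t : ℝ) : ℝ :=
  sSup (absValues ℓ d t)

end

/-! The difference `d = u - U` has zero initial and Neumann data and solves `d_xx + ε d_xxt - d_tt -
α d_t = s - ε g`, where `s = sin u - sin U` satisfies `|s| ≤ |d|` and `g = U_xxt` is bounded by `b`.
The energy `E` of `energyDensity` contains `d_t + α/2 d` rather than `d_t`; with these weights the
cross terms cancel in `E'`, and what is left is at most `(2/α + δ) E + ℓ (ε b)² / (2δ)` for every `δ
> 0` (`energyDensity_growth`).

Choosing `δ = 1/τ` on `[0, τ]`, Grönwall gives `E(τ) ≲ (ε τ)² exp(2τ/α)`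
(`integral_energyDensity_le`). A Sobolev inequality in `x` turns this into `|d| ≲ ε t exp(t/α)`,
with a constant free of `ε`. For `t < L = log(1/ε^k)` the exponential is at most `ε^(-k/α)`, and the
remaining factor `t` becomes the logarithm. -/

/-! ### Continuity and parametric integrals on a rectangle. -/

/-- A function continuous on a rectangle agrees there with a globally continuous one. -/
theorem ContOnRect.exists_continuous_extension {ℓ T : ℝ} (hℓ : 0 ≤ ℓ) (hT : 0 ≤ T)
    {f : ℝ → ℝ → ℝ} (hf : ContOnRect ℓ T f) :
    ∃ g : ℝ → ℝ → ℝ, Continuous (Function.uncurry g) ∧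
      ∀ x ∈ Icc 0 ℓ, ∀ t ∈ Icc 0 T, g x t = f x t := by
  refine ⟨fun x t => f (projIcc 0 ℓ hℓ x) (projIcc 0 T hT t), ?_, fun x hx t ht => ?_⟩
  · refine ContinuousOn.comp_continuous
      (f := fun p : ℝ × ℝ => ((projIcc 0 ℓ hℓ p.1 : ℝ), (projIcc 0 T hT p.2 : ℝ))) hf ?_ ?_
    · exact (continuous_subtype_val.comp (continuous_projIcc.comp continuous_fst)).prodMk
        (continuous_subtype_val.comp (continuous_projIcc.comp continuous_snd))
    · exact fun p => ⟨Subtype.coe_prop _, Subtype.coe_prop _⟩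
  · simp only [projIcc_of_mem hℓ hx, projIcc_of_mem hT ht]

theorem ContOnRect.continuousOn_left {ℓ T : ℝ} {f : ℝ → ℝ → ℝ} (hf : ContOnRect ℓ T f)
    {t : ℝ} (ht : t ∈ Icc 0 T) : ContinuousOn (fun x => f x t) (Icc 0 ℓ) :=
  ContinuousOn.comp (g := fun p : ℝ × ℝ => f p.1 p.2) hf
    (by fun_prop : Continuous fun x : ℝ => (x, t)).continuousOn (fun _ hx => ⟨hx, ht⟩)

theorem ContOnRect.mono {ℓ T T' : ℝ} {f : ℝ → ℝ → ℝ} (hf : ContOnRect ℓ T f) (h : T' ≤ T) :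
    ContOnRect ℓ T' f :=
  ContinuousOn.mono hf (prod_mono_right (Icc_subset_Icc_right h))

theorem ContOnRect.intervalIntegrable {ℓ T : ℝ} {f : ℝ → ℝ → ℝ} (hf : ContOnRect ℓ T f)
    {t : ℝ} (ht : t ∈ Icc 0 T) {a c : ℝ} (ha : a ∈ Icc 0 ℓ) (hc : c ∈ Icc 0 ℓ) :
    IntervalIntegrable (fun x => f x t) MeasureTheory.volume a c :=
  ((hf.continuousOn_left ht).mono (ordConnected_Icc.uIcc_subset ha hc)).intervalIntegrable

theorem ContOnRect.continuousOn_integral {ℓ T : ℝ} (hℓ : 0 ≤ ℓ) (hT : 0 ≤ T)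
    {f : ℝ → ℝ → ℝ} (hf : ContOnRect ℓ T f) :
    ContinuousOn (fun t => ∫ x in (0 : ℝ)..ℓ, f x t) (Icc 0 T) := by
  obtain ⟨g, hg, hgf⟩ := hf.exists_continuous_extension hℓ hT
  have hc : Continuous fun t => ∫ x in (0 : ℝ)..ℓ, g x t :=
    intervalIntegral.continuous_parametric_intervalIntegral_of_continuous'
      (f := fun t x => g x t) (hg.comp continuous_swap) 0 ℓ
  refine hc.continuousOn.congr fun t ht => intervalIntegral.integral_congr fun x hx => ?_
  rw [uIcc_of_le hℓ] at hx
  exact (hgf x hx t ht).symm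

/-- Differentiation under the integral sign on a rectangle. -/
theorem hasDerivAt_integral_of_contOnRect {ℓ T : ℝ} {F F' : ℝ → ℝ → ℝ}
    (hF : ContOnRect ℓ T F) (hF' : ContOnRect ℓ T F')
    (h : ∀ x ∈ Icc 0 ℓ, ∀ t ∈ Ioo 0 T, HasDerivAt (F x) (F' x t) t)
    {a t : ℝ} (ha : a ∈ Icc 0 ℓ) (ht : t ∈ Ioo 0 T) :
    HasDerivAt (fun s => ∫ x in (0 : ℝ)..a, F x s) (∫ x in (0 : ℝ)..a, F' x t) t := by
  have h0 : (0 : ℝ) ∈ Icc 0 ℓ := ⟨le_rfl, ha.1.trans ha.2⟩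
  have hsub : uIoc 0 a ⊆ Icc 0 ℓ :=
    uIoc_subset_uIcc.trans (ordConnected_Icc.uIcc_subset h0 ha)
  obtain ⟨C, hC⟩ := (isCompact_Icc.prod isCompact_Icc).exists_bound_of_continuousOn hF'
  have hmem : ∀ {s}, s ∈ Ioo 0 T → s ∈ Icc 0 T := fun hs => Ioo_subset_Icc_self hs
  refine (intervalIntegral.hasDerivAt_integral_of_dominated_loc_of_deriv_le
    (F := fun s x => F x s) (F' := fun s x => F' x s) (bound := fun _ => C)
    (isOpen_Ioo.mem_nhds ht) ?_ (hF.intervalIntegrable (hmem ht) h0 ha)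
    (hF'.intervalIntegrable (hmem ht) h0 ha).def'.aestronglyMeasurable ?_ ?_ ?_).2
  · filter_upwards [isOpen_Ioo.mem_nhds ht] with s hs
    exact (hF.intervalIntegrable (hmem hs) h0 ha).def'.aestronglyMeasurable
  · exact Filter.Eventually.of_forall fun x hx s hs => hC (x, s) ⟨hsub hx, hmem hs⟩
  · exact intervalIntegrable_const
  · exact Filter.Eventually.of_forall fun x hx s hs => h x (hsub hx) s hs

/-! ### Partial derivatives and their symmetry. -/

theorem HasDx.hasDerivAt {ℓ T : ℝ} {f : ℝ → ℝ → ℝ} (h : HasDx ℓ T f) {x t : ℝ}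
    (hx : x ∈ Ioo 0 ℓ) (ht : t ∈ Icc 0 T) : HasDerivAt (fun y => f y t) (Dx ℓ f x t) x :=
  (h x (Ioo_subset_Icc_self hx) t ht).hasDerivWithinAt.hasDerivAt (Icc_mem_nhds hx.1 hx.2)

theorem HasDt.hasDerivAt {ℓ T : ℝ} {f : ℝ → ℝ → ℝ} (h : HasDt ℓ T f) {x t : ℝ}
    (hx : x ∈ Icc 0 ℓ) (ht : t ∈ Ioo 0 T) : HasDerivAt (f x) (Dt T f x t) t :=
  (h x hx t (Ioo_subset_Icc_self ht)).hasDerivWithinAt.hasDerivAt (Icc_mem_nhds ht.1 ht.2)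

/-- Symmetry of the mixed second derivatives, up to the lateral sides of the rectangle. -/
theorem IsC2OnRect.dx_dt_eq_dt_dx {ℓ T : ℝ} (hℓ : 0 < ℓ) {f : ℝ → ℝ → ℝ}
    (hf : IsC2OnRect ℓ T f) {x t : ℝ} (hx : x ∈ Icc 0 ℓ) (ht : t ∈ Ioo 0 T) :
    Dx ℓ (Dt T f) x t = Dt T (Dx ℓ f) x t := by
  have h0 : (0 : ℝ) ∈ Icc 0 ℓ := ⟨le_rfl, hℓ.le⟩
  have htI := Ioo_subset_Icc_self ht
  -- Differentiate `f a s - f 0 s = ∫ f_x` in time under the integral; differentiating the result in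
  -- `a` then yields the symmetry.
  have key : ∀ a ∈ Icc 0 ℓ,
      Dt T f a t = Dt T f 0 t + ∫ y in (0 : ℝ)..a, Dt T (Dx ℓ f) y t := by
    intro a ha
    have h1 := hasDerivAt_integral_of_contOnRect hf.c1Dx.cont hf.c1Dx.contDt
      (fun x hx t ht => hf.c1Dx.hasDt.hasDerivAt hx ht) ha ht
    have h2 : HasDerivAt (fun s => f a s - f 0 s) (Dt T f a t - Dt T f 0 t) t :=
      (hf.c1.hasDt.hasDerivAt ha ht).sub (hf.c1.hasDt.hasDerivAt h0 ht)
    have h3 : (fun s => f a s - f 0 s) =ᶠ[nhds t] fun s => ∫ y in (0 : ℝ)..a, Dx ℓ f y s := by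
      filter_upwards [isOpen_Ioo.mem_nhds ht] with s hs
      have hsI := Ioo_subset_Icc_self hs
      refine (intervalIntegral.integral_eq_sub_of_hasDerivAt_of_le (f := fun y => f y s) ha.1
        ((hf.c1.cont.continuousOn_left hsI).mono (Icc_subset_Icc_right ha.2))
        (fun y hy => hf.c1.hasDx.hasDerivAt ⟨hy.1, hy.2.trans_le ha.2⟩ hsI)
        (hf.c1.contDx.intervalIntegrable hsI h0 ha)).symm
    have := h2.unique (h1.congr_of_eventuallyEq h3)
    linarith
  -- With a continuous extension of the integrand, the fundamental theorem of calculus also applies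
  -- at `x = 0` and `x = ℓ`.
  obtain ⟨g, hg, hgf⟩ :=
    hf.c1Dx.contDt.exists_continuous_extension hℓ.le (ht.1.trans ht.2).le
  have hgt : Continuous fun y => g y t := hg.comp (by fun_prop : Continuous fun y : ℝ => (y, t))
  have hd : HasDerivWithinAt (fun y => Dt T f y t) (g x t) (Icc 0 ℓ) x := by
    refine HasDerivWithinAt.congr
      (f := fun a => Dt T f 0 t + ∫ y in (0 : ℝ)..a, g y t) ?_ (fun a ha => ?_) ?_
    · exact ((intervalIntegral.integral_hasDerivAt_right (hgt.intervalIntegrable _ _)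
        hgt.stronglyMeasurable.stronglyMeasurableAtFilter hgt.continuousAt).const_add
        _).hasDerivWithinAt
    all_goals
      rw [key _ (by assumption)]
      congr 1
      refine intervalIntegral.integral_congr fun y hy => (hgf y ?_ t htI).symm
      exact ordConnected_Icc.uIcc_subset h0 (by assumption) hy
  rw [← hgf x hx t htI]
  exact hd.derivWithin (uniqueDiffOn_Icc hℓ x hx)

/-! ### Sobolev inequality and energy estimate. -/

/-- A one-dimensional Sobolev inequality. -/
theorem mul_sq_le_integral_sq_add_sq {ℓ : ℝ} {q v : ℝ → ℝ}
    (hq : ContinuousOn q (Icc 0 ℓ)) (hv : ContinuousOn v (Icc 0 ℓ))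
    (h : ∀ x ∈ Ioo 0 ℓ, HasDerivAt q (v x) x) {x : ℝ} (hx : x ∈ Icc 0 ℓ) :
    ℓ * q x ^ 2 ≤ (1 + ℓ) * ∫ y in (0 : ℝ)..ℓ, (q y ^ 2 + v y ^ 2) := by
  have hℓ : 0 ≤ ℓ := hx.1.trans hx.2
  have hφ : ContinuousOn (fun y => q y ^ 2 + v y ^ 2) (Icc 0 ℓ) := (hq.pow 2).add (hv.pow 2)
  have hint : ∀ a ∈ Icc 0 ℓ, ∀ c ∈ Icc 0 ℓ, IntervalIntegrable (fun y => q y ^ 2 + v y ^ 2)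
      MeasureTheory.volume a c := fun a ha c hc =>
    (hφ.mono (ordConnected_Icc.uIcc_subset ha hc)).intervalIntegrable
  have h0 : (0 : ℝ) ∈ Icc 0 ℓ := ⟨le_rfl, hℓ⟩
  have h1 : ℓ ∈ Icc 0 ℓ := ⟨hℓ, le_rfl⟩
  have hsub : ∀ a ∈ Icc 0 ℓ, ∀ c ∈ Icc 0 ℓ, a ≤ c →
      ∫ y in a..c, (q y ^ 2 + v y ^ 2) ≤ ∫ y in (0 : ℝ)..ℓ, (q y ^ 2 + v y ^ 2) := by
    intro a ha c hc hac
    refine intervalIntegral.integral_mono_interval ha.1 hac hc.2 ?_ (hint 0 h0 ℓ h1)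
    exact Filter.Eventually.of_forall fun y => by positivity
  -- The derivative of `±q²` is `±2qv ≤ q² + v²`.
  have hosc : ∀ y ∈ Icc 0 ℓ,
      q x ^ 2 ≤ q y ^ 2 + ∫ y in (0 : ℝ)..ℓ, (q y ^ 2 + v y ^ 2) := by
    intro y hy
    rcases le_total y x with hyx | hxy
    · have := intervalIntegral.sub_le_integral_of_hasDeriv_right_of_le (g := fun y => q y ^ 2)
        (g' := fun y => 2 * q y * v y) (φ := fun y => q y ^ 2 + v y ^ 2) hyx
        ((hq.pow 2).mono (Icc_subset_Icc hy.1 hx.2))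
        (fun z hz => (((h z ⟨hy.1.trans_lt hz.1, hz.2.trans_le hx.2⟩).pow 2).congr_deriv
          (by simp)).hasDerivWithinAt)
        ((hφ.mono (Icc_subset_Icc hy.1 hx.2)).integrableOn_Icc)
        (fun z _ => two_mul_le_add_sq _ _)
      linarith [hsub y hy x hx hyx]
    · have := intervalIntegral.sub_le_integral_of_hasDeriv_right_of_le (g := fun y => -q y ^ 2)
        (g' := fun y => -(2 * q y * v y)) (φ := fun y => q y ^ 2 + v y ^ 2) hxy
        (((hq.pow 2).neg).mono (Icc_subset_Icc hx.1 hy.2))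
        (fun z hz => (((h z ⟨hx.1.trans_lt hz.1, hz.2.trans_le hy.2⟩).pow 2).neg.congr_deriv
          (by simp)).hasDerivWithinAt)
        ((hφ.mono (Icc_subset_Icc hx.1 hy.2)).integrableOn_Icc)
        (fun z _ => by nlinarith [sq_nonneg (q z + v z)])
      linarith [hsub x hx y hy hxy]
  have hq2 : IntervalIntegrable (fun y => q y ^ 2) MeasureTheory.volume 0 ℓ :=
    ContinuousOn.intervalIntegrable (by rw [uIcc_of_le hℓ]; exact hq.pow 2)
  -- Average over `y`.
  have hle := intervalIntegral.integral_mono_on hℓ intervalIntegrable_const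
    (hq2.add intervalIntegrable_const) hosc
  have hle' : ∫ y in (0 : ℝ)..ℓ, q y ^ 2 ≤ ∫ y in (0 : ℝ)..ℓ, (q y ^ 2 + v y ^ 2) :=
    intervalIntegral.integral_mono_on hℓ hq2 (hint 0 h0 ℓ h1)
      fun y _ => by linarith [sq_nonneg (v y)]
  rw [intervalIntegral.integral_add hq2 intervalIntegrable_const] at hle
  simp only [intervalIntegral.integral_const, sub_zero, smul_eq_mul] at hle
  linarith

/-- The density of the energy whose growth rate is `2 / α`. -/
noncomputable def energyDensity (α ε q p v : ℝ) : ℝ :=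
  (p + α / 2 * q) ^ 2 / 2 + α ^ 2 / 8 * q ^ 2 + (1 + ε * α / 2) * v ^ 2 / 2

/-- The algebra behind the energy inequality: `s` is the Lipschitz nonlinearity and `ε * g` the
forcing term. -/
theorem energyDensity_growth {α ε b δ q p v z s g : ℝ} (hα : 0 < α) (hε : 0 ≤ ε) (hδ : 0 < δ)
    (hs : |s| ≤ |q|) (hg : |g| ≤ b) :
    -ε * z ^ 2 - α / 2 * v ^ 2 - α / 2 * p ^ 2 - (p + α / 2 * q) * (s - ε * g)
      ≤ (2 / α + δ) * energyDensity α ε q p v + (ε * b) ^ 2 / (2 * δ) := by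
  -- This is `s² ≤ q²` rewritten; it lets the completed square in `h4` be absorbed at the rate `2 /
  -- α`.
  have h1 : (q + s) ^ 2 ≤ 2 * (q * (q + s)) := by nlinarith [sq_le_sq.2 hs]
  have h2 : 0 ≤ (α / 2 + 1 / α) * p ^ 2 + p * (q + s) + α / 2 * (q * (q + s)) := by
    have h3 : 0 ≤ 1 / α * (p + α / 2 * (q + s)) ^ 2 := by positivity
    have h4 : 1 / α * (p + α / 2 * (q + s)) ^ 2
        = 1 / α * p ^ 2 + p * (q + s) + α / 4 * (q + s) ^ 2 := by
      field_simp
      ring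
    nlinarith [mul_le_mul_of_nonneg_left h1 hα.le, mul_nonneg hα.le (sq_nonneg p)]
  -- Young's inequality with weight `δ`.
  have h5 : (p + α / 2 * q) * (ε * g) ≤ δ * ((p + α / 2 * q) ^ 2 / 2) + (ε * b) ^ 2 / (2 * δ) := by
    have h6 : (ε * g) ^ 2 ≤ (ε * b) ^ 2 := by
      rw [mul_pow, mul_pow]
      exact mul_le_mul_of_nonneg_left (sq_le_sq.2 (hg.trans (le_abs_self b))) (sq_nonneg ε)
    have h7 : 0 ≤ (δ * (p + α / 2 * q) - ε * g) ^ 2 / (2 * δ) := by positivity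
    have h8 : (δ * (p + α / 2 * q) - ε * g) ^ 2 / (2 * δ) = δ * ((p + α / 2 * q) ^ 2 / 2)
        - (p + α / 2 * q) * (ε * g) + (ε * g) ^ 2 / (2 * δ) := by
      field_simp
      ring
    have h9 : (ε * g) ^ 2 / (2 * δ) ≤ (ε * b) ^ 2 / (2 * δ) := by gcongr
    linarith
  have h10 : 2 / α * energyDensity α ε q p v = 1 / α * p ^ 2 + p * q + α / 2 * q ^ 2
      + (1 + ε * α / 2) * v ^ 2 / α := by
    unfold energyDensity
    field_simp
    ring
  have h11 : δ * ((p + α / 2 * q) ^ 2 / 2) ≤ δ * energyDensity α ε q p v := by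
    have : 0 ≤ α ^ 2 / 8 * q ^ 2 + (1 + ε * α / 2) * v ^ 2 / 2 := by positivity
    exact mul_le_mul_of_nonneg_left (by unfold energyDensity; linarith) hδ.le
  have h12 : 0 ≤ (1 + ε * α / 2) * v ^ 2 / α := by positivity
  have h13 : 0 ≤ ε * z ^ 2 := by positivity
  have h14 : 0 ≤ α / 2 * v ^ 2 := by positivity
  nlinarith

/-- Energy estimate for the strongly damped wave equation with Neumann boundary conditions, zero
initial data, a nonlinearity bounded by `|q|` and a forcing term bounded by `ε * b`. -/
theorem integral_energyDensity_le {ℓ α ε b τ : ℝ} (hℓ : 0 < ℓ) (hα : 0 < α) (hε : 0 ≤ ε)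
    (hτ : 0 < τ) {q p v z vx pt w : ℝ → ℝ → ℝ}
    (hq : ContOnRect ℓ τ q) (hp : ContOnRect ℓ τ p) (hv : ContOnRect ℓ τ v)
    (hz : ContOnRect ℓ τ z) (hpt : ContOnRect ℓ τ pt)
    (hqt : ∀ x ∈ Icc 0 ℓ, ∀ t ∈ Ioo 0 τ, HasDerivAt (q x) (p x t) t)
    (hptt : ∀ x ∈ Icc 0 ℓ, ∀ t ∈ Ioo 0 τ, HasDerivAt (p x) (pt x t) t)
    (hvt : ∀ x ∈ Icc 0 ℓ, ∀ t ∈ Ioo 0 τ, HasDerivAt (v x) (z x t) t)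
    (hqx : ∀ x ∈ Ioo 0 ℓ, ∀ t ∈ Ioo 0 τ, HasDerivAt (fun y => q y t) (v x t) x)
    (hpx : ∀ x ∈ Ioo 0 ℓ, ∀ t ∈ Ioo 0 τ, HasDerivAt (fun y => p y t) (z x t) x)
    (hvx : ∀ x ∈ Ioo 0 ℓ, ∀ t ∈ Ioo 0 τ, HasDerivAt (fun y => v y t) (vx x t) x)
    (hzx : ∀ x ∈ Ioo 0 ℓ, ∀ t ∈ Ioo 0 τ, HasDerivAt (fun y => z y t) (w x t) x)
    (hv0 : ∀ t ∈ Ioo 0 τ, v 0 t = 0 ∧ v ℓ t = 0) (hz0 : ∀ t ∈ Ioo 0 τ, z 0 t = 0 ∧ z ℓ t = 0)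
    (heq : ∀ x ∈ Ioo 0 ℓ, ∀ t ∈ Ioo 0 τ, ∃ s g, |s| ≤ |q x t| ∧ |g| ≤ b ∧
      vx x t + ε * w x t - pt x t - α * p x t = s - ε * g)
    (hinit : ∀ x ∈ Icc 0 ℓ, q x 0 = 0 ∧ p x 0 = 0 ∧ v x 0 = 0) :
    ∫ x in (0 : ℝ)..ℓ, energyDensity α ε (q x τ) (p x τ) (v x τ)
      ≤ Real.exp (2 * τ / α + 1) * (τ ^ 2 * ℓ * (ε * b) ^ 2 / 2) := by
  set e : ℝ → ℝ → ℝ := fun x t => energyDensity α ε (q x t) (p x t) (v x t) with he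
  set et : ℝ → ℝ → ℝ := fun x t => (p x t + α / 2 * q x t) * (pt x t + α / 2 * p x t)
    + α ^ 2 / 4 * q x t * p x t + (1 + ε * α / 2) * v x t * z x t with het
  have hec : ContOnRect ℓ τ e := by
    unfold ContOnRect at *
    simp only [he, energyDensity]
    fun_prop
  have hetc : ContOnRect ℓ τ et := by
    unfold ContOnRect at *
    simp only [het]
    fun_prop
  have hed : ∀ x ∈ Icc 0 ℓ, ∀ t ∈ Ioo 0 τ, HasDerivAt (e x) (et x t) t := by
    intro x hx t ht
    have d1 := ((((hptt x hx t ht).add ((hqt x hx t ht).const_mul (α / 2))).pow 2).div_const 2)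
    have d2 := ((hqt x hx t ht).pow 2).const_mul (α ^ 2 / 8)
    have d3 := (((hvt x hx t ht).pow 2).const_mul (1 + ε * α / 2)).div_const 2
    refine ((d1.add d2).add d3).congr_deriv ?_
    simp only [het, Pi.add_apply]
    push_cast
    ring
  set E : ℝ → ℝ := fun t => ∫ x in (0 : ℝ)..ℓ, e x t with hE
  have hEc : ContinuousOn E (Icc 0 τ) := hec.continuousOn_integral hℓ.le hτ.le
  have h0 : (0 : ℝ) ∈ Icc 0 ℓ := ⟨le_rfl, hℓ.le⟩
  have h1 : ℓ ∈ Icc 0 ℓ := ⟨hℓ.le, le_rfl⟩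
  have hEd : ∀ t ∈ Ioo 0 τ, HasDerivAt E (∫ x in (0 : ℝ)..ℓ, et x t) t := fun t ht =>
    hasDerivAt_integral_of_contOnRect hec hetc hed h1 ht
  -- Here `δ = 1 / τ`: over a time `τ` this costs only a factor `exp 1`, and the forcing contributes
  -- a factor `τ ^ 2`.
  set K : ℝ := (ε * b) ^ 2 / (2 * (1 / τ)) with hK
  set r : ℝ := 2 / α + 1 / τ with hr
  have hgrowth : ∀ t ∈ Ioo 0 τ, ∫ x in (0 : ℝ)..ℓ, et x t ≤ r * E t + ℓ * K := by
    intro t ht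
    have htI := Ioo_subset_Icc_self ht
    have hei := hec.intervalIntegrable htI h0 h1
    have heti := hetc.intervalIntegrable htI h0 h1
    -- Integration by parts in one-sided form: `vx` and `w` exist only pointwise and need not be
    -- integrable, but the derivative of the flux is bounded by a continuous `φ`. The flux vanishes
    -- at both ends because `v` and `z` do.
    have hΦ := intervalIntegral.sub_le_integral_of_hasDeriv_right_of_le
      (g := fun x => -((p x t + α / 2 * q x t) * (v x t + ε * z x t)))
      (g' := fun x => -((z x t + α / 2 * v x t) * (v x t + ε * z x t)
        + (p x t + α / 2 * q x t) * (vx x t + ε * w x t)))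
      (φ := fun x => r * e x t + K - et x t) hℓ.le
      ((((hp.continuousOn_left htI).add (continuousOn_const.mul (hq.continuousOn_left htI))).mul
        ((hv.continuousOn_left htI).add
          (continuousOn_const.mul (hz.continuousOn_left htI)))).neg)
      (fun x hx => ((((hpx x hx t ht).add ((hqx x hx t ht).const_mul (α / 2))).mul
        ((hvx x hx t ht).add ((hzx x hx t ht).const_mul ε))).neg).hasDerivWithinAt)
      ((((continuousOn_const.mul (hec.continuousOn_left htI)).add continuousOn_const).sub
        (hetc.continuousOn_left htI)).integrableOn_Icc)
      (fun x hx => by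
        obtain ⟨s, g, hs, hg, hsg⟩ := heq x hx t ht
        have hgr := energyDensity_growth (p := p x t) (v := v x t) (z := z x t) hα hε
          (by positivity : 0 < 1 / τ) hs hg
        have hw : vx x t + ε * w x t = pt x t + α * p x t + (s - ε * g) := by linarith
        simp only [hw, het, he]
        linarith)
    rw [intervalIntegral.integral_sub ((hei.const_mul r).add intervalIntegrable_const) heti,
      intervalIntegral.integral_add (hei.const_mul r) intervalIntegrable_const,
      intervalIntegral.integral_const_mul, intervalIntegral.integral_const] at hΦ
    simp only [(hv0 t ht).1, (hv0 t ht).2, (hz0 t ht).1, (hz0 t ht).2, smul_eq_mul,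
      sub_zero] at hΦ
    simp only [hE]
    linarith
  have hr0 : 0 ≤ r := by positivity
  have hK0 : 0 ≤ ℓ * K := by positivity
  -- Grönwall's argument with an integrating factor.
  have hanti : AntitoneOn (fun t => Real.exp (-r * t) * E t - ℓ * K * t) (Icc 0 τ) := by
    have hd : ∀ t ∈ Ioo 0 τ, HasDerivAt (fun t => Real.exp (-r * t) * E t - ℓ * K * t)
        (Real.exp (-r * t) * (-r) * E t + Real.exp (-r * t) * (∫ x in (0 : ℝ)..ℓ, et x t)
          - ℓ * K) t := by
      intro t ht
      have d1 : HasDerivAt (fun t => Real.exp (-r * t)) (Real.exp (-r * t) * (-r)) t := by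
        simpa using ((hasDerivAt_id t).const_mul (-r)).exp
      have d2 : HasDerivAt (fun t => ℓ * K * t) (ℓ * K) t := by
        simpa using (hasDerivAt_id t).const_mul (ℓ * K)
      exact (d1.mul (hEd t ht)).sub d2
    refine antitoneOn_of_deriv_nonpos (convex_Icc 0 τ) ?_ ?_ ?_
    · have : Continuous fun t : ℝ => Real.exp (-r * t) := by fun_prop
      exact (this.continuousOn.mul hEc).sub (by fun_prop)
    · rw [interior_Icc]
      exact fun t ht => (hd t ht).differentiableAt.differentiableWithinAt
    · rw [interior_Icc]
      intro t ht
      rw [(hd t ht).deriv]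
      have hle : Real.exp (-r * t) ≤ 1 := Real.exp_le_one_iff.2 (by nlinarith [ht.1])
      nlinarith [mul_le_mul_of_nonneg_left (hgrowth t ht) (Real.exp_pos (-r * t)).le,
        mul_le_mul_of_nonneg_right hle hK0]
  have hE0 : E 0 = 0 := by
    have : EqOn (fun x => e x 0) (fun _ => 0) (uIcc 0 ℓ) := by
      intro x hx
      rw [uIcc_of_le hℓ.le] at hx
      obtain ⟨a1, a2, a3⟩ := hinit x hx
      simp [he, energyDensity, a1, a2, a3]
    simp only [hE, intervalIntegral.integral_congr this, intervalIntegral.integral_zero]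
  have hfin := hanti ⟨le_rfl, hτ.le⟩ ⟨hτ.le, le_rfl⟩ hτ.le
  simp only [hE0, mul_zero, sub_zero] at hfin
  have hrτ : r * τ = 2 * τ / α + 1 := by
    rw [hr]
    field_simp
  have hKτ : ℓ * K * τ = τ ^ 2 * ℓ * (ε * b) ^ 2 / 2 := by
    rw [hK]
    field_simp
  rw [← hrτ, ← hKτ]
  have hexp : Real.exp (r * τ) * Real.exp (-r * τ) = 1 := by
    rw [← Real.exp_add]
    simp
  calc E τ = Real.exp (r * τ) * (Real.exp (-r * τ) * E τ) := by rw [← mul_assoc, hexp, one_mul]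
    _ ≤ Real.exp (r * τ) * (ℓ * K * τ) :=
      mul_le_mul_of_nonneg_left (by linarith) (Real.exp_pos _).le

/-- The energy controls the function pointwise. -/
theorem sq_le_of_integral_energyDensity {ℓ α ε : ℝ} (hα : 0 < α) (hε : 0 ≤ ε)
    {q p v : ℝ → ℝ} (hq : ContinuousOn q (Icc 0 ℓ)) (hp : ContinuousOn p (Icc 0 ℓ))
    (hv : ContinuousOn v (Icc 0 ℓ)) (h : ∀ x ∈ Ioo 0 ℓ, HasDerivAt q (v x) x)
    {x : ℝ} (hx : x ∈ Icc 0 ℓ) :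
    ℓ * (min (α ^ 2 / 8) (1 / 2) * q x ^ 2)
      ≤ (1 + ℓ) * ∫ y in (0 : ℝ)..ℓ, energyDensity α ε (q y) (p y) (v y) := by
  have hℓ : 0 ≤ ℓ := hx.1.trans hx.2
  -- The weights of `q²` and `v²` in the energy at `ε = 0`; the `ε` term only adds to it.
  set c := min (α ^ 2 / 8) (1 / 2 : ℝ)
  have hc0 : 0 ≤ c := le_min (by positivity) (by norm_num)
  have hle : c * ∫ y in (0 : ℝ)..ℓ, (q y ^ 2 + v y ^ 2)
      ≤ ∫ y in (0 : ℝ)..ℓ, energyDensity α ε (q y) (p y) (v y) := by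
    rw [← intervalIntegral.integral_const_mul]
    refine intervalIntegral.integral_mono_on hℓ ?_ ?_ fun y _ => ?_
    · exact ContinuousOn.intervalIntegrable (by rw [uIcc_of_le hℓ]; fun_prop)
    · exact ContinuousOn.intervalIntegrable
        (by rw [uIcc_of_le hℓ]; simp only [energyDensity]; fun_prop)
    · have h1 : c * q y ^ 2 ≤ α ^ 2 / 8 * q y ^ 2 :=
        mul_le_mul_of_nonneg_right (min_le_left _ _) (sq_nonneg _)
      have h2 : c * v y ^ 2 ≤ 1 / 2 * v y ^ 2 :=
        mul_le_mul_of_nonneg_right (min_le_right _ _) (sq_nonneg _)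
      have h3 : 0 ≤ (p y + α / 2 * q y) ^ 2 / 2 + ε * α / 2 * v y ^ 2 / 2 := by positivity
      unfold energyDensity
      linarith
  have hsob := mul_le_mul_of_nonneg_left (mul_sq_le_integral_sq_add_sq hq hv h hx) hc0
  have := mul_le_mul_of_nonneg_left hle (by linarith : 0 ≤ 1 + ℓ)
  linarith

/-! ### The difference of the two solutions. -/

/-- The pointwise bound, linear in `ε` and of growth rate `1 / α`, for the difference of the two
solutions. -/
theorem sq_sub_le {ℓ α b : ℝ} (hℓ : 0 < ℓ) (hα : 0 < α)
    {ε γ T : ℝ} (hε : 0 < ε) {h₀ h₁ φ₀ φ₁ : ℝ → ℝ} {u U : ℝ → ℝ → ℝ}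
    (hu : IsPerturbedSolution ℓ T α γ ε h₀ h₁ φ₀ φ₁ u)
    (hU : IsReducedSolution ℓ T α γ h₀ h₁ φ₀ φ₁ U) (hU3 : HasDxxt ℓ T U)
    (hUb : ∀ x ∈ Icc 0 ℓ, ∀ t ∈ Icc 0 T, |Dxxt ℓ T U x t| ≤ b)
    {τ : ℝ} (hτ : 0 < τ) (hτT : τ ≤ T) {x : ℝ} (hx : x ∈ Icc 0 ℓ) :
    min (α ^ 2 / 8) (1 / 2) * (u x τ - U x τ) ^ 2
      ≤ (1 + ℓ) * Real.exp 1 * b ^ 2 / 2 * (ε * τ * Real.exp (τ / α)) ^ 2 := by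
  have hIoo : ∀ {t}, t ∈ Ioo 0 τ → t ∈ Ioo 0 T := fun ht => ⟨ht.1, ht.2.trans_le hτT⟩
  have hIcc : ∀ {t}, t ∈ Ioo 0 τ → t ∈ Icc 0 T := fun ht => Ioo_subset_Icc_self (hIoo ht)
  have hxI : ∀ {x}, x ∈ Ioo 0 ℓ → x ∈ Icc 0 ℓ := fun hx => Ioo_subset_Icc_self hx
  have h0 : (0 : ℝ) ∈ Icc 0 ℓ := ⟨le_rfl, hℓ.le⟩
  have h1 : ℓ ∈ Icc 0 ℓ := ⟨hℓ.le, le_rfl⟩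
  have hsubc : ∀ {f g : ℝ → ℝ → ℝ}, ContOnRect ℓ T f → ContOnRect ℓ T g →
      ContOnRect ℓ τ (fun x t => f x t - g x t) := fun hf hg =>
    ContOnRect.mono (ContinuousOn.sub hf hg) hτT
  have hqc := hsubc hu.c2.c1.cont hU.c2.c1.cont
  have hpc := hsubc hu.c2.c1.contDt hU.c2.c1.contDt
  have hvc := hsubc hu.c2.c1.contDx hU.c2.c1.contDx
  have hmix : ∀ {f : ℝ → ℝ → ℝ}, IsC2OnRect ℓ T f → ∀ x ∈ Icc 0 ℓ, ∀ t ∈ Ioo 0 τ,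
      HasDerivAt (Dx ℓ f x) (Dx ℓ (Dt T f) x t) t := fun hf x hx t ht => by
    rw [hf.dx_dt_eq_dt_dx hℓ hx (hIoo ht)]
    exact hf.c1Dx.hasDt.hasDerivAt hx (hIoo ht)
  -- Differentiate the common Neumann data in time; symmetry of mixed derivatives up to the lateral
  -- sides is needed here.
  have hbd : ∀ {a : ℝ}, a ∈ Icc 0 ℓ → (∀ t ∈ Icc 0 T, Dx ℓ u a t = Dx ℓ U a t) →
      ∀ t ∈ Ioo 0 τ, Dx ℓ (Dt T u) a t - Dx ℓ (Dt T U) a t = 0 := by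
    intro a ha hbc t ht
    refine sub_eq_zero.2 ((hmix hu.c2 a ha t ht).unique
      ((hmix hU.c2 a ha t ht).congr_of_eventuallyEq ?_))
    filter_upwards [isOpen_Ioo.mem_nhds ht] with s hs using hbc s (hIcc hs)
  have hleft : ∀ t ∈ Icc 0 T, Dx ℓ u 0 t = Dx ℓ U 0 t := fun t ht => by
    rw [hu.data.left t ht, hU.data.left t ht]
  have hright : ∀ t ∈ Icc 0 T, Dx ℓ u ℓ t = Dx ℓ U ℓ t := fun t ht => by
    rw [hu.data.right t ht, hU.data.right t ht]
  have hE := integral_energyDensity_le (b := b) (ε := ε) (τ := τ) hℓ hα hε.le hτ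
    (vx := fun x t => Dx ℓ (Dx ℓ u) x t - Dx ℓ (Dx ℓ U) x t)
    (w := fun x t => Dxxt ℓ T u x t - Dxxt ℓ T U x t) hqc hpc hvc
    (hsubc hu.c2.c1Dt.contDx hU.c2.c1Dt.contDx) (hsubc hu.c2.c1Dt.contDt hU.c2.c1Dt.contDt)
    (fun x hx t ht => (hu.c2.c1.hasDt.hasDerivAt hx (hIoo ht)).sub
      (hU.c2.c1.hasDt.hasDerivAt hx (hIoo ht)))
    (fun x hx t ht => (hu.c2.c1Dt.hasDt.hasDerivAt hx (hIoo ht)).sub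
      (hU.c2.c1Dt.hasDt.hasDerivAt hx (hIoo ht)))
    (fun x hx t ht => (hmix hu.c2 x hx t ht).sub (hmix hU.c2 x hx t ht))
    (fun x hx t ht => (hu.c2.c1.hasDx.hasDerivAt hx (hIcc ht)).sub
      (hU.c2.c1.hasDx.hasDerivAt hx (hIcc ht)))
    (fun x hx t ht => (hu.c2.c1Dt.hasDx.hasDerivAt hx (hIcc ht)).sub
      (hU.c2.c1Dt.hasDx.hasDerivAt hx (hIcc ht)))
    (fun x hx t ht => (hu.c2.c1Dx.hasDx.hasDerivAt hx (hIcc ht)).sub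
      (hU.c2.c1Dx.hasDx.hasDerivAt hx (hIcc ht)))
    (fun x hx t ht => (HasDx.hasDerivAt hu.hasDxxt hx (hIcc ht)).sub
      (HasDx.hasDerivAt hU3 hx (hIcc ht)))
    (fun t ht => ⟨sub_eq_zero.2 (hleft t (hIcc ht)), sub_eq_zero.2 (hright t (hIcc ht))⟩)
    (fun t ht => ⟨hbd h0 hleft t ht, hbd h1 hright t ht⟩)
    (fun x hx t ht => ⟨Real.sin (u x t) - Real.sin (U x t), Dxxt ℓ T U x t,
      Real.abs_sin_sub_sin_le _ _, hUb x (hxI hx) t (hIcc ht), by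
        linarith [hu.eqn x (hxI hx) t (hIcc ht), hU.eqn x (hxI hx) t (hIcc ht)]⟩)
    (fun x hx => by
      have hinit : EqOn (fun y => u y 0) (fun y => U y 0) (Icc 0 ℓ) := fun y hy =>
        (hu.data.init y hy).trans (hU.data.init y hy).symm
      exact ⟨sub_eq_zero.2 (hinit hx),
        sub_eq_zero.2 ((hu.data.init_t x hx).trans (hU.data.init_t x hx).symm),
        sub_eq_zero.2 (derivWithin_congr hinit (hinit hx))⟩)
  have hτI : τ ∈ Icc 0 τ := ⟨hτ.le, le_rfl⟩
  have hsq := sq_le_of_integral_energyDensity (ε := ε) hα hε.le (hqc.continuousOn_left hτI)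
    (hpc.continuousOn_left hτI) (hvc.continuousOn_left hτI)
    (fun x hx => (hu.c2.c1.hasDx.hasDerivAt hx ⟨hτ.le, hτT⟩).sub
      (hU.c2.c1.hasDx.hasDerivAt hx ⟨hτ.le, hτT⟩)) hx
  have hexp : Real.exp (2 * τ / α + 1) = Real.exp (τ / α) ^ 2 * Real.exp 1 := by
    rw [Real.exp_add, ← Real.exp_nat_mul]
    congr 2
    push_cast
    ring
  rw [hexp] at hE
  refine le_of_mul_le_mul_left (hsq.trans ?_) hℓ
  refine (mul_le_mul_of_nonneg_left hE (by linarith)).trans_eq ?_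
  ring

theorem theorem5p1 (ℓ α b : ℝ) (hℓ : 0 < ℓ) (hα : 0 < α) (hb : 0 < b) :
    ∃ Γ : ℝ, 0 < Γ ∧
      ∀ k : ℝ, 0 < k → k < α →
      ∀ ε : ℝ, 0 < ε → ε < 1 →
      ∀ (γ T : ℝ), 0 < T →
      ∀ (h₀ h₁ φ₀ φ₁ : ℝ → ℝ) (u U : ℝ → ℝ → ℝ),
        IsPerturbedSolution ℓ T α γ ε h₀ h₁ φ₀ φ₁ u →
        IsReducedSolution ℓ T α γ h₀ h₁ φ₀ φ₁ U →
        HasDxxt ℓ T U →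
        (∀ x ∈ Set.Icc 0 ℓ, ∀ t ∈ Set.Icc 0 T, |Dxxt ℓ T U x t| ≤ b) →
        ∀ t : ℝ, 1 ≤ t → t ≤ T → t < Real.log (1 / ε ^ k) →
          BddAbove (absValues ℓ (fun x s => u x s - U x s) t) ∧
          0 ≤ supAbs ℓ (fun x s => u x s - U x s) t ∧
          supAbs ℓ (fun x s => u x s - U x s) t
            ≤ Γ * ε ^ (1 - k / α) * Real.log (1 / ε ^ k) := by
  set c := min (α ^ 2 / 8) (1 / 2 : ℝ)
  have hc : 0 < c := lt_min (by positivity) (by norm_num)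
  set C := (1 + ℓ) * Real.exp 1 * b ^ 2 / 2
  have hC : 0 < C := by positivity
  refine ⟨√(C / c), Real.sqrt_pos.2 (by positivity), ?_⟩
  intro k _ _ ε hε _ γ T _ h₀ h₁ φ₀ φ₁ u U hu hU hU3 hUb t ht1 htT htL
  set L := Real.log (1 / ε ^ k) with hL
  have hexpL : Real.exp (L / α) = ε ^ (-(k / α)) := by
    rw [hL, one_div, Real.log_inv, Real.log_rpow hε, Real.rpow_def_of_pos hε]
    congr 1
    ring
  have hL0 : 0 < L := by linarith
  have hbound : ∀ x ∈ Icc 0 ℓ, |u x t - U x t| ≤ √(C / c) * ε ^ (1 - k / α) * L := by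
    intro x hx
    have hsq := sq_sub_le hℓ hα hε hu hU hU3 hUb (by linarith : 0 < t) htT hx
    have h1 : |u x t - U x t| ≤ √(C / c) * (ε * t * Real.exp (t / α)) := by
      refine abs_le_of_sq_le_sq ?_ (by positivity)
      rw [mul_pow, Real.sq_sqrt (by positivity), div_mul_eq_mul_div, le_div_iff₀ hc, mul_comm]
      exact hsq
    -- Both factors increase in `t`, so `t` may be replaced by `L`.
    have h2 : ε * t * Real.exp (t / α) ≤ ε * L * Real.exp (L / α) := by gcongr
    refine h1.trans ((mul_le_mul_of_nonneg_left h2 (Real.sqrt_nonneg _)).trans_eq ?_)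
    rw [hexpL, sub_eq_add_neg, Real.rpow_add hε, Real.rpow_one]
    ring
  exact ⟨⟨_, forall_mem_image.2 hbound⟩,
    Real.sSup_nonneg (forall_mem_image.2 fun x _ => abs_nonneg _),
    csSup_le ⟨_, mem_image_of_mem _ (left_mem_Icc.2 hℓ.le)⟩ (forall_mem_image.2 hbound)⟩
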